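/- Consider a library of $n$ items and a cache holding $m$ distinct items, $1\le m<n$. A state is a vector $\boldsymbol x=(x_1,\dots,x_m)$ of pairwise distinct items. Requests are independent, and each request is for item $i$ with probability $p_i=A/i^{\alpha}$, $i=1,\dots,n$, where $\alpha\ge 0$ and $A=\bigl(\sum_{j=1}^n j^{-\alpha}\bigr)^{-1}$ (the Zipf($\alpha$) law). Under LRU (least recently used), when item $i$ is requested it is placed in the first position; if $i$ was not in the cache, all other items move back one position and the item in the last position is evicted; if $i$ was in position $j$, the items in positions $1,\dots,j-1$ move back one position and the others stay. Let $P$ be the transition matrix of the resulting Markov chain (one step per request). Then $P$ has a unique stationary distribution $\pi^*$, and the mixing time $$t_{\mathrm{mix}}^{\mathrm{LRU}}=\min\Bigl\{t\ge 0:\ \sup_{\boldsymbol x}\bigl\|P^t(\boldsymbol x,\cdot)-\pi^*\bigr\|_{TV}\le \tfrac12\Bigr\},\qquad \|\mu-\nu\|_{TV}=\tfrac12\sum_{\boldsymbol y}|\mu(\boldsymbol y)-\nu(\boldsymbol y)|,$$ exists and satisfies $$t_{\mathrm{mix}}^{\mathrm{LRU}}=O\bigl(n^{(4\alpha+2)m+2}\ln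 n\bigr),$$ that is, for every $\alpha\ge 0$ there is a constant $C>0$ depending only on $\alpha$ such that $t_{\mathrm{mix}}^{\mathrm{LRU}}\le C\,n^{(4\alpha+2)m+2}\ln n$ for all integers $1\le m<n$. -/

import Mathlib

open scoped Matrix

/-! ### Finite Markov chains: stationary distributions, total variation, mixing times -/

/-- `π` is a stationary distribution of the transition matrix `P`: a probability vector with
`π P = π`. -/
def IsStationaryDist {S : Type*} [Fintype S] (P : Matrix S S ℝ) (π : S → ℝ) : Prop :=
  (∀ x, 0 ≤ π x) ∧ ∑ x, π x = 1 ∧ π ᵥ* P = π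

/-- Total variation distance of two probability vectors on a finite set. -/
noncomputable def tvDist {S : Type*} [Fintype S] (μ ν : S → ℝ) : ℝ :=
  (1 / 2) * ∑ x, |μ x - ν x|

/-- The worst-case (over the initial state) total variation distance from `π` after `t` steps.
The row of `P ^ t` at `x` is the law of the chain after `t` steps started from `x`. -/
noncomputable def distToStationary {S : Type*} [Fintype S] [DecidableEq S]
    (P : Matrix S S ℝ) (π : S → ℝ) (t : ℕ) : ℝ :=
  ⨆ x : S, tvDist ((P ^ t) x) π

/-- `T` is the mixing time `t_mix(ε)`: the smallest `t` for which the worst-case total variation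
distance from `π` after `t` steps is at most `ε`. -/
def IsMixingTime {S : Type*} [Fintype S] [DecidableEq S]
    (P : Matrix S S ℝ) (π : S → ℝ) (ε : ℝ) (T : ℕ) : Prop :=
  IsLeast {t : ℕ | distToStationary P π t ≤ ε} T

/-! ### The LRU cache -/

/-- A state of a cache of size `m` over a library of `n` items: the vector of the (pairwise
distinct) items in the cache spots. Spot `0` is the first spot. -/
abbrev CacheState (n m : ℕ) : Type := Fin m ↪ Fin n

/-- The content of spot `j` after the request of item `i` in state `x` under LRU. The requested
item is put in the first spot. An item in front of spot `j` equal to `i` means a hit strictly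
before `j`, and then spot `j` is unchanged. Otherwise spot `j` receives the item of the previous
spot. -/
def lruContent {n m : ℕ} (i : Fin n) (x : CacheState n m) (j : Fin m) : Fin n :=
  if j.val = 0 then i
  else if ∃ k : Fin m, k < j ∧ x k = i then x j
  else x ⟨j.val - 1, lt_of_le_of_lt (Nat.sub_le _ _) j.isLt⟩

theorem lruContent_injective {n m : ℕ} (i : Fin n) (x : CacheState n m) :
    Function.Injective (lruContent i x) := by
  have key : ∀ a b : Fin m, a < b → lruContent i x a ≠ lruContent i x b := by
    intro a b hab h
    have hb : b.val ≠ 0 := by have : a.val < b.val := hab; omega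
    have hab' : a.val < b.val := hab
    unfold lruContent at h
    rw [if_neg hb] at h
    by_cases ha : a.val = 0
    · rw [if_pos ha] at h
      by_cases h2 : ∃ k : Fin m, k < b ∧ x k = i
      · rw [if_pos h2] at h
        obtain ⟨k, hk, hki⟩ := h2
        exact absurd (x.injective (hki.trans h)) (ne_of_lt hk)
      · rw [if_neg h2] at h
        exact h2 ⟨_, Fin.lt_def.2 (by simp only; omega), h.symm⟩
    · rw [if_neg ha] at h
      by_cases h1 : ∃ k : Fin m, k < a ∧ x k = i
      · have h2 : ∃ k : Fin m, k < b ∧ x k = i := by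
          obtain ⟨k, hk, hki⟩ := h1
          exact ⟨k, hk.trans hab, hki⟩
        rw [if_pos h1, if_pos h2] at h
        exact absurd (x.injective h) (ne_of_lt hab)
      · rw [if_neg h1] at h
        by_cases h2 : ∃ k : Fin m, k < b ∧ x k = i
        · rw [if_pos h2] at h
          have := congrArg Fin.val (x.injective h)
          simp only at this
          omega
        · rw [if_neg h2] at h
          have := congrArg Fin.val (x.injective h)
          simp only at this
          omega
  intro a b h
  rcases lt_trichotomy a b with hab | hab | hab
  · exact absurd h (key a b hab)
  · exact hab
  · exact absurd h.symm (key b a hab)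

/-- The state after the request of item `i` in state `x` under LRU. -/
def lruStep {n m : ℕ} (i : Fin n) (x : CacheState n m) : CacheState n m :=
  ⟨lruContent i x, lruContent_injective i x⟩

/-- The transition matrix of the LRU chain, one step per request, when the requests are
independent and item `i` is requested with probability `p i`. -/
def lruMatrix {n : ℕ} (m : ℕ) (p : Fin n → ℝ) : Matrix (CacheState n m) (CacheState n m) ℝ :=
  Matrix.of fun x y => ∑ i : Fin n, if lruStep i x = y then p i else 0

/-- The Zipf popularity law with parameter `α` on `n` items: the `i`-th most popular item, for
`i = 1, …, n`, has probability `A / i ^ α`, where `A` is the normalization constant. Items are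
numbered from `0` in the code. -/
noncomputable def zipf (α : ℝ) (n : ℕ) (i : Fin n) : ℝ :=
  (∑ j : Fin n, 1 / ((j.val : ℝ) + 1) ^ α)⁻¹ / ((i.val : ℝ) + 1) ^ α

/-! ### Doeblin's condition -/

section Doeblin

variable {S : Type*} [Fintype S] [DecidableEq S]

/-! Requesting `m` distinct items in a fixed order leads to the same state from every start. With `q
= n ^ (-(α + 1))` a lower bound for all Zipf probabilities, one column of `P ^ m` is therefore at
least `δ = q ^ m` (`exists_pow_le_lruMatrix_pow`). This is Doeblin's condition: `P ^ m` contracts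
zero-sum vectors in `ℓ¹` by the factor `1 - δ`, which gives uniqueness and a mixing time of at most
`2 * m / δ` (`exists_isMixingTime_le_of_minorized`). The result, of order `m * n ^ ((α + 1) * m)`,
is below the claimed bound. -/

theorem sum_vecMul_of_rowStochastic {Q : Matrix S S ℝ} (hQ : Q ∈ Matrix.rowStochastic ℝ S)
    (ν : S → ℝ) : ∑ y, (ν ᵥ* Q) y = ∑ x, ν x := by
  simp only [Matrix.vecMul, dotProduct]
  rw [Finset.sum_comm]
  refine Finset.sum_congr rfl fun x _ => ?_
  rw [← Finset.mul_sum, Matrix.sum_row_of_mem_rowStochastic hQ, mul_one]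

/-- Subtracting `δ` from column `y₀` keeps `Q` nonnegative, lowers each row sum to `1 - δ`, and does
not change `ν ᵥ* Q`, because `ν` has zero sum. -/
theorem sum_abs_vecMul_le_of_minorized {Q : Matrix S S ℝ} (hQ : Q ∈ Matrix.rowStochastic ℝ S)
    {δ : ℝ} {y₀ : S} (hδ : ∀ x, δ ≤ Q x y₀) {ν : S → ℝ} (hν : ∑ x, ν x = 0) :
    ∑ y, |(ν ᵥ* Q) y| ≤ (1 - δ) * ∑ x, |ν x| := by
  have hnn : ∀ x y, 0 ≤ Q x y - (if y = y₀ then δ else 0) := by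
    intro x y
    split_ifs with h
    · subst h
      exact sub_nonneg.2 (hδ x)
    · simpa using Matrix.nonneg_of_mem_rowStochastic hQ
  calc ∑ y, |(ν ᵥ* Q) y|
      = ∑ y, |∑ x, ν x * (Q x y - (if y = y₀ then δ else 0))| := by
        refine Finset.sum_congr rfl fun y _ => ?_
        simp only [mul_sub, Finset.sum_sub_distrib, ← Finset.sum_mul, hν, zero_mul, sub_zero]
        rfl
    _ ≤ ∑ y, ∑ x, |ν x| * (Q x y - (if y = y₀ then δ else 0)) := by
        refine Finset.sum_le_sum fun y _ => (Finset.abs_sum_le_sum_abs _ _).trans_eq ?_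
        refine Finset.sum_congr rfl fun x _ => ?_
        rw [abs_mul, abs_of_nonneg (hnn x y)]
    _ = (1 - δ) * ∑ x, |ν x| := by
        rw [Finset.sum_comm, Finset.mul_sum]
        refine Finset.sum_congr rfl fun x _ => ?_
        rw [← Finset.mul_sum, Finset.sum_sub_distrib, Matrix.sum_row_of_mem_rowStochastic hQ]
        simp [mul_comm]

theorem sum_abs_vecMul_pow_le_of_minorized {Q : Matrix S S ℝ}
    (hQ : Q ∈ Matrix.rowStochastic ℝ S) {δ : ℝ} {y₀ : S} (hδ : ∀ x, δ ≤ Q x y₀)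
    (hδ1 : δ ≤ 1) {ν : S → ℝ} (hν : ∑ x, ν x = 0) (k : ℕ) :
    ∑ y, |(ν ᵥ* Q ^ k) y| ≤ (1 - δ) ^ k * ∑ x, |ν x| := by
  induction k with
  | zero => simp
  | succ k ih =>
    have h0 : ∑ y, (ν ᵥ* Q ^ k) y = 0 := by
      rw [sum_vecMul_of_rowStochastic (pow_mem hQ k), hν]
    rw [pow_succ, ← Matrix.vecMul_vecMul, pow_succ', mul_assoc]
    exact (sum_abs_vecMul_le_of_minorized hQ hδ h0).trans
      (mul_le_mul_of_nonneg_left ih (sub_nonneg.2 hδ1))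

theorem vecMul_pow_eq_self {P : Matrix S S ℝ} {v : S → ℝ} (hv : v ᵥ* P = v) (k : ℕ) :
    v ᵥ* P ^ k = v := by
  induction k with
  | zero => simp
  | succ k ih => rw [pow_succ, ← Matrix.vecMul_vecMul, ih, hv]

theorem eq_zero_of_vecMul_eq_self_of_minorized {P : Matrix S S ℝ}
    (hP : P ∈ Matrix.rowStochastic ℝ S) {m : ℕ} {δ : ℝ} {y₀ : S}
    (hδ : ∀ x, δ ≤ (P ^ m) x y₀) (hδ0 : 0 < δ) {v : S → ℝ} (hv : v ᵥ* P = v)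
    (hsum : ∑ x, v x = 0) : v = 0 := by
  have h := sum_abs_vecMul_le_of_minorized (pow_mem hP m) hδ hsum
  rw [vecMul_pow_eq_self hv] at h
  have h0 : 0 ≤ ∑ x, |v x| := Finset.sum_nonneg fun _ _ => abs_nonneg _
  have h1 : ∑ x, |v x| = 0 := by nlinarith
  rw [Finset.sum_eq_zero_iff_of_nonneg fun _ _ => abs_nonneg _] at h1
  funext x
  simpa using h1 x (Finset.mem_univ x)

/-- Row sums equal to one make `P - 1` singular, so there is a left fixed vector `v ≠ 0`. Entrywise
`|v| ≤ |v| P`, and both sides have the same total mass, so `|v|` is fixed too and can be normalized.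
-/
theorem exists_isStationaryDist [Nonempty S] {P : Matrix S S ℝ}
    (hP : P ∈ Matrix.rowStochastic ℝ S) : ∃ π, IsStationaryDist P π := by
  obtain ⟨v, hv0, hv⟩ : ∃ v : S → ℝ, v ≠ 0 ∧ v ᵥ* P = v := by
    have h1 : ∃ w : S → ℝ, w ≠ 0 ∧ (P - 1) *ᵥ w = 0 := by
      refine ⟨1, one_ne_zero, ?_⟩
      rw [Matrix.sub_mulVec, Matrix.one_mulVec, Matrix.one_vecMul_of_mem_rowStochastic hP,
        sub_self]
    obtain ⟨v, hv0, hv⟩ := Matrix.exists_vecMul_eq_zero_iff.2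
      (Matrix.exists_mulVec_eq_zero_iff.1 h1)
    refine ⟨v, hv0, ?_⟩
    rwa [Matrix.vecMul_sub, Matrix.vecMul_one, sub_eq_zero] at hv
  set u : S → ℝ := fun x => |v x| with hu
  have hle : ∀ y, u y ≤ (u ᵥ* P) y := by
    intro y
    calc u y = |(v ᵥ* P) y| := by rw [hv]
      _ ≤ ∑ x, |v x * P x y| := Finset.abs_sum_le_sum_abs _ _
      _ = (u ᵥ* P) y := Finset.sum_congr rfl fun x _ => by
        rw [abs_mul, abs_of_nonneg (Matrix.nonneg_of_mem_rowStochastic hP)]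
  have hfix : u ᵥ* P = u := by
    have h := (Finset.sum_eq_sum_iff_of_le fun y _ => hle y).1
      (sum_vecMul_of_rowStochastic hP u).symm
    exact funext fun y => (h y (Finset.mem_univ y)).symm
  have hpos : 0 < ∑ x, u x := by
    obtain ⟨x, hx⟩ := Function.ne_iff.1 hv0
    exact Finset.sum_pos' (fun _ _ => abs_nonneg _) ⟨x, Finset.mem_univ x, abs_pos.2 hx⟩
  refine ⟨(∑ x, u x)⁻¹ • u, fun x => ?_, ?_, ?_⟩
  · exact mul_nonneg (inv_nonneg.2 hpos.le) (abs_nonneg _)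
  · simp only [Pi.smul_apply, smul_eq_mul]
    rw [← Finset.mul_sum, inv_mul_cancel₀ hpos.ne']
  · rw [Matrix.smul_vecMul, hfix]

theorem distToStationary_mul_le_of_minorized [Nonempty S] {P : Matrix S S ℝ}
    (hP : P ∈ Matrix.rowStochastic ℝ S) {m : ℕ} {δ : ℝ} {y₀ : S}
    (hδ : ∀ x, δ ≤ (P ^ m) x y₀) (hδ1 : δ ≤ 1) {π : S → ℝ} (hπ : IsStationaryDist P π) (k : ℕ) :
    distToStationary P π (m * k) ≤ (1 - δ) ^ k := by
  obtain ⟨hπ0, hπ1, hπP⟩ := hπ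
  refine ciSup_le fun x => ?_
  have hs : ∑ y, ((Pi.single x 1 : S → ℝ) - π) y = 0 := by simp [hπ1]
  have h := sum_abs_vecMul_pow_le_of_minorized (pow_mem hP m) hδ hδ1 hs k
  rw [← pow_mul, Matrix.sub_vecMul, Matrix.single_one_vecMul, vecMul_pow_eq_self hπP] at h
  have h2 : ∑ y, |((Pi.single x 1 : S → ℝ) - π) y| ≤ 2 := by
    calc ∑ y, |((Pi.single x 1 : S → ℝ) - π) y|
        ≤ ∑ y, ((Pi.single x 1 : S → ℝ) y + π y) := by
          refine Finset.sum_le_sum fun y _ => (abs_sub _ _).trans_eq ?_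
          rw [abs_of_nonneg (hπ0 y), abs_of_nonneg]
          rw [Pi.single_apply]
          split_ifs <;> norm_num
      _ = 2 := by
          rw [Finset.sum_add_distrib, hπ1]
          simp
          norm_num
  have h3 : 0 ≤ (1 - δ) ^ k := pow_nonneg (sub_nonneg.2 hδ1) k
  have h4 := mul_le_mul_of_nonneg_left h2 h3
  unfold tvDist
  simp only [Pi.sub_apply, Matrix.row_apply] at h h4
  linarith

theorem exists_isMixingTime_le_of_minorized [Nonempty S] {P : Matrix S S ℝ}
    (hP : P ∈ Matrix.rowStochastic ℝ S) {m : ℕ} {δ : ℝ} {y₀ : S}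
    (hδ : ∀ x, δ ≤ (P ^ m) x y₀) (hδ0 : 0 < δ) (hδ1 : δ ≤ 1) {π : S → ℝ}
    (hπ : IsStationaryDist P π) :
    ∃ T : ℕ, IsMixingTime P π (1 / 2) T ∧ (T : ℝ) ≤ 2 * m / δ := by
  -- Then `(1 - δ) ^ k ≤ exp (-1) ≤ 1 / 2`; rounding up at most doubles `1 / δ`, since `δ ≤ 1`.
  set k := ⌈1 / δ⌉₊ with hk
  have hk1 : 1 / δ ≤ k := Nat.le_ceil _
  have hk2 : (k : ℝ) ≤ 2 / δ := by
    have h1 : (k : ℝ) < 1 / δ + 1 := Nat.ceil_lt_add_one (by positivity)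
    have h2 : 1 ≤ 1 / δ := by rwa [le_div_iff₀ hδ0, one_mul]
    have h3 : 2 / δ = 1 / δ + 1 / δ := by ring
    linarith
  have hmem : m * k ∈ {t : ℕ | distToStationary P π t ≤ 1 / 2} := by
    refine (distToStationary_mul_le_of_minorized hP hδ hδ1 hπ k).trans ?_
    calc (1 - δ) ^ k ≤ Real.exp (-δ) ^ k :=
          pow_le_pow_left₀ (sub_nonneg.2 hδ1) (Real.one_sub_le_exp_neg δ) k
      _ = Real.exp (-(δ * k)) := by rw [← Real.exp_nat_mul]; ring_nf
      _ ≤ Real.exp (-1) := by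
          rw [div_le_iff₀ hδ0] at hk1
          exact Real.exp_le_exp.2 (by linarith)
      _ ≤ 1 / 2 := by
          rw [Real.exp_neg, one_div]
          refine inv_anti₀ two_pos ?_
          linarith [Real.add_one_le_exp (1 : ℝ)]
  classical
  refine ⟨Nat.find ⟨_, hmem⟩, ⟨Nat.find_spec ⟨_, hmem⟩, fun t ht => Nat.find_min' _ ht⟩, ?_⟩
  have hle : Nat.find ⟨_, hmem⟩ ≤ m * k := Nat.find_min' _ hmem
  calc ((Nat.find ⟨_, hmem⟩ : ℕ) : ℝ) ≤ ((m * k : ℕ) : ℝ) := Nat.cast_le.2 hle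
    _ = m * k := Nat.cast_mul _ _
    _ ≤ m * (2 / δ) := mul_le_mul_of_nonneg_left hk2 (Nat.cast_nonneg _)
    _ = 2 * m / δ := by ring

end Doeblin

/-! ### The LRU chain -/

section LRU

variable {n m : ℕ}

theorem lruMatrix_mem_rowStochastic {p : Fin n → ℝ} (hp : ∀ i, 0 ≤ p i) (hp1 : ∑ i, p i = 1) :
    lruMatrix m p ∈ Matrix.rowStochastic ℝ (CacheState n m) := by
  rw [Matrix.mem_rowStochastic_iff_sum]
  refine ⟨fun x y => ?_, fun x => ?_⟩
  · rw [lruMatrix, Matrix.of_apply]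
    refine Finset.sum_nonneg fun i _ => ?_
    split_ifs
    exacts [hp i, le_rfl]
  · simp only [lruMatrix, Matrix.of_apply]
    rw [Finset.sum_comm]
    simpa using hp1

theorem le_lruMatrix_lruStep {p : Fin n → ℝ} (hp : ∀ i, 0 ≤ p i) (i : Fin n)
    (x : CacheState n m) : p i ≤ lruMatrix m p x (lruStep i x) := by
  have h := Finset.single_le_sum (s := Finset.univ)
    (f := fun k => if lruStep k x = lruStep i x then p k else 0)
    (fun k _ => by split_ifs; exacts [hp k, le_rfl]) (Finset.mem_univ i)
  simpa [lruMatrix] using h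

/-- The state after the successive requests of the items `a 0, …, a (k - 1)`. -/
def lruIterate (a : ℕ → Fin n) (x : CacheState n m) : ℕ → CacheState n m
  | 0 => x
  | k + 1 => lruStep (a k) (lruIterate a x k)

theorem pow_le_lruMatrix_pow_lruIterate {p : Fin n → ℝ} {q : ℝ} (hp1 : ∑ i, p i = 1)
    (hq : 0 ≤ q) (hqp : ∀ i, q ≤ p i) (a : ℕ → Fin n) (x : CacheState n m) (k : ℕ) :
    q ^ k ≤ (lruMatrix m p ^ k) x (lruIterate a x k) := by
  have hp : ∀ i, 0 ≤ p i := fun i => hq.trans (hqp i)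
  have hP := lruMatrix_mem_rowStochastic (m := m) hp hp1
  induction k with
  | zero => simp [lruIterate]
  | succ k ih =>
    rw [pow_succ, pow_succ, Matrix.mul_apply]
    refine le_trans ?_ (Finset.single_le_sum (fun w _ => mul_nonneg
      (Matrix.nonneg_of_mem_rowStochastic (pow_mem hP k))
      (Matrix.nonneg_of_mem_rowStochastic hP)) (Finset.mem_univ (lruIterate a x k)))
    exact mul_le_mul ih ((hqp _).trans (le_lruMatrix_lruStep hp _ _)) hq ((pow_nonneg hq k).trans ih)

/-- After `k` distinct requests the first `k` spots list them, latest first. The next request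
differs from all of these, so no hit occurs among them and they all shift back. -/
theorem lruIterate_apply {a : ℕ → Fin n} (x : CacheState n m) {k : ℕ}
    (ha : Set.InjOn a (Set.Iio k)) (j : Fin m) (hj : j.val < k) :
    lruIterate a x k j = a (k - 1 - j) := by
  induction k generalizing j with
  | zero => omega
  | succ k ih =>
    have ih := ih (ha.mono (Set.Iio_subset_Iio k.le_succ))
    change lruContent (a k) (lruIterate a x k) j = _
    unfold lruContent
    split_ifs with h0 h1
    · simp [h0]
    · obtain ⟨l, hl, hlk⟩ := h1
      have hlj : l.val < j.val := hl
      rw [ih l (by omega)] at hlk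
      have := ha (Set.mem_Iio.2 (by omega)) (Set.mem_Iio.2 (by omega)) hlk
      omega
    · rw [ih _ (by simp only; omega)]
      congr 1
      simp only
      omega

theorem exists_pow_le_lruMatrix_pow (hm : 1 ≤ m) (hmn : m < n) {p : Fin n → ℝ} {q : ℝ}
    (hp1 : ∑ i, p i = 1) (hq : 0 ≤ q) (hqp : ∀ i, q ≤ p i) :
    ∃ y : CacheState n m, ∀ x, q ^ m ≤ (lruMatrix m p ^ m) x y := by
  have hn : 0 < n := by omega
  -- The reduction mod `n` only makes `a` total; the indices used are below `m < n`.
  set a : ℕ → Fin n := fun k => ⟨k % n, Nat.mod_lt _ hn⟩ with ha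
  have hinj : Set.InjOn a (Set.Iio m) := by
    intro i hi j hj hij
    have h := congrArg Fin.val hij
    simp only [ha, Set.mem_Iio] at h hi hj
    rwa [Nat.mod_eq_of_lt (hi.trans hmn), Nat.mod_eq_of_lt (hj.trans hmn)] at h
  -- The start `Fin.castLEEmb` is arbitrary and only serves to name the common end state.
  refine ⟨lruIterate a (Fin.castLEEmb hmn.le) m, fun x => ?_⟩
  have h : lruIterate a (Fin.castLEEmb hmn.le) m = lruIterate a x m := by
    ext j
    rw [lruIterate_apply _ hinj j j.isLt, lruIterate_apply _ hinj j j.isLt]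
  rw [h]
  exact pow_le_lruMatrix_pow_lruIterate hp1 hq hqp a x m

end LRU

/-! ### The Zipf law -/

theorem zipf_weight_sum_pos (α : ℝ) {n : ℕ} (hn : 0 < n) :
    0 < ∑ j : Fin n, 1 / ((j.val : ℝ) + 1) ^ α :=
  Finset.sum_pos (fun j _ => by positivity) ⟨⟨0, hn⟩, Finset.mem_univ _⟩

theorem sum_zipf (α : ℝ) {n : ℕ} (hn : 0 < n) : ∑ i, zipf α n i = 1 := by
  have h : ∀ i, zipf α n i = (∑ j : Fin n, 1 / ((j.val : ℝ) + 1) ^ α)⁻¹ *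
      (1 / ((i.val : ℝ) + 1) ^ α) := fun i => by rw [zipf, div_eq_mul_one_div]
  rw [Finset.sum_congr rfl fun i _ => h i, ← Finset.mul_sum,
    inv_mul_cancel₀ (zipf_weight_sum_pos α hn).ne']

theorem rpow_neg_le_zipf {α : ℝ} (hα : 0 ≤ α) {n : ℕ} (hn : 0 < n) (i : Fin n) :
    (n : ℝ) ^ (-(α + 1)) ≤ zipf α n i := by
  have hn0 : (0 : ℝ) < n := Nat.cast_pos.2 hn
  have hS : ∑ j : Fin n, 1 / ((j.val : ℝ) + 1) ^ α ≤ n := by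
    calc ∑ j : Fin n, 1 / ((j.val : ℝ) + 1) ^ α ≤ ∑ _j : Fin n, (1 : ℝ) := by
          refine Finset.sum_le_sum fun j _ => ?_
          have hj : (1 : ℝ) ≤ (j.val : ℝ) + 1 := le_add_of_nonneg_left (Nat.cast_nonneg _)
          exact div_le_one_of_le₀ (Real.one_le_rpow hj hα) (by positivity)
      _ = n := by simp
  have hi : ((i.val : ℝ) + 1) ^ α ≤ (n : ℝ) ^ α := by
    refine Real.rpow_le_rpow (by positivity) ?_ hα
    exact_mod_cast i.isLt
  calc (n : ℝ) ^ (-(α + 1)) = (n : ℝ)⁻¹ / (n : ℝ) ^ α := by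
        rw [Real.rpow_neg hn0.le, Real.rpow_add hn0, Real.rpow_one, mul_inv, mul_comm,
          div_eq_mul_inv]
    _ ≤ zipf α n i :=
        div_le_div₀ (inv_nonneg.2 (zipf_weight_sum_pos α hn).le)
          (inv_anti₀ (zipf_weight_sum_pos α hn) hS) (by positivity) hi

theorem mainTheorem12 (α : ℝ) (hα : 0 ≤ α) :
    ∃ C : ℝ, 0 < C ∧ ∀ m n : ℕ, 1 ≤ m → m < n →
      ∃ π : CacheState n m → ℝ,
        IsStationaryDist (lruMatrix m (zipf α n)) π ∧
        (∀ π' : CacheState n m → ℝ, IsStationaryDist (lruMatrix m (zipf α n)) π' → π' = π) ∧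
        ∃ T : ℕ, IsMixingTime (lruMatrix m (zipf α n)) π (1 / 2) T ∧
          (T : ℝ) ≤ C * ((n : ℝ) ^ ((4 * α + 2) * (m : ℝ) + 2) * Real.log (n : ℝ)) := by
  -- The constant is `2`, from `2 * m / δ`, doubled to absorb `log n ≥ log 2 ≥ 1 / 2`.
  refine ⟨4, by norm_num, fun m n hm hmn => ?_⟩
  have hn : 0 < n := by omega
  have hn2 : (2 : ℝ) ≤ n := by exact_mod_cast (by omega : 2 ≤ n)
  have hn0 : (0 : ℝ) < n := by linarith
  have hn1 : (1 : ℝ) ≤ n := by linarith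
  have hmn' : (m : ℝ) ≤ n := by exact_mod_cast hmn.le
  have hm0 : (0 : ℝ) ≤ m := Nat.cast_nonneg m
  set q : ℝ := (n : ℝ) ^ (-(α + 1)) with hq
  have hq0 : 0 < q := Real.rpow_pos_of_pos hn0 _
  have hq1 : q ≤ 1 := Real.rpow_le_one_of_one_le_of_nonpos hn1 (by linarith)
  have hqp : ∀ i, q ≤ zipf α n i := rpow_neg_le_zipf hα hn
  have hp1 := sum_zipf α hn
  have hP := lruMatrix_mem_rowStochastic (m := m) (fun i => hq0.le.trans (hqp i)) hp1
  obtain ⟨y, hy⟩ := exists_pow_le_lruMatrix_pow hm hmn hp1 hq0.le hqp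
  have : Nonempty (CacheState n m) := ⟨y⟩
  obtain ⟨π, hπ⟩ := exists_isStationaryDist hP
  obtain ⟨T, hT, hTle⟩ := exists_isMixingTime_le_of_minorized hP hy (pow_pos hq0 m)
    (pow_le_one₀ hq0.le hq1) hπ
  refine ⟨π, hπ, fun π' hπ' => ?_, T, hT, hTle.trans ?_⟩
  · refine sub_eq_zero.1 (eq_zero_of_vecMul_eq_self_of_minorized hP hy (pow_pos hq0 m) ?_ ?_)
    · rw [Matrix.sub_vecMul, hπ'.2.2, hπ.2.2]
    · simp [hπ'.2.1, hπ.2.1]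
  · have hlog : 1 / 2 ≤ Real.log n := by
      have := Real.log_le_log two_pos hn2
      linarith [Real.log_two_gt_d9]
    calc 2 * m / q ^ m = 2 * m * (n : ℝ) ^ ((α + 1) * m) := by
          rw [hq, ← Real.rpow_mul_natCast hn0.le, neg_mul, Real.rpow_neg hn0.le, div_inv_eq_mul]
      _ ≤ 2 * (n : ℝ) * (n : ℝ) ^ ((α + 1) * m) := by gcongr
      _ = 2 * (n : ℝ) ^ ((α + 1) * m + 1) := by
          rw [Real.rpow_add hn0, Real.rpow_one]
          ring
      _ ≤ 2 * (n : ℝ) ^ ((4 * α + 2) * (m : ℝ) + 2) := by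
          gcongr
          · linarith
          · linarith
          · norm_num
      _ ≤ 4 * ((n : ℝ) ^ ((4 * α + 2) * (m : ℝ) + 2) * Real.log n) := by
          have := mul_le_mul_of_nonneg_left hlog
            (Real.rpow_nonneg hn0.le ((4 * α + 2) * (m : ℝ) + 2))
          linarith
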